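/- Let $p$ be a prime, $k$ an algebraically closed field of characteristic $p$, and $P$ a finite $p$-group. Let $\mathcal F$ be a constrained fusion system on $P$, that is, a saturated fusion system with $C_P(O_p(\mathcal F))\le O_p(\mathcal F)$, where $O_p(\mathcal F)$ is the largest normal subgroup of $\mathcal F$. Let $\mathfrak M$ be a model for $\mathcal F$: a finite group containing $P$ as a Sylow $p$-subgroup such that $\mathcal F=\mathcal F_P(\mathfrak M)$ (the fusion system of conjugations by elements of $\mathfrak M$), $O_{p'}(\mathfrak M)=1$, and $\mathfrak M$ is $p$-constrained, i.e. $O_p(\mathfrak M/O_{p'}(\mathfrak M))$ contains its centralizer in $\mathfrak M/O_{p'}(\mathfrak M)$. Let $G=\mathrm{Park}(\mathcal F,\mathfrak M)$ be the group of all bijections $f:\mathfrak M\to\mathfrak M$ with $f(mu)=f(m)u$ for all $m\in\mathfrak M$, $u\in P$, and let $\iota:\mathfrak M\to G$, $\iota(m)=(x\mapsto mx)$, be Park's embedding. Then $G$ is isomorphic to the wreath product $P\wr S_n$ with $n=|\mathfrak M:P|$, and $$\mathrm{Sc}(G,\iota P)\cong \mathrm{Ind}_{\iota\mathfrak M}^G(k).$$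 Here, for a subgroup $H\le G$, the Scott module $\mathrm{Sc}(G,H)$ is the (up to isomorphism unique) indecomposable direct summand of $\mathrm{Ind}_H^G(k)$ whose socle contains the trivial module $k_G$. Explicitly, $\mathrm{Ind}_{\iota\mathfrak M}^G(k)$ is an indecomposable direct summand, up to isomorphism, of $\mathrm{Ind}_{\iota P}^G(k)$ with a nonzero $G$-fixed vector, and every $kG$-module with these properties is isomorphic to it. -/

import Mathlib

/-! ### Fusion systems -/

/-- A fusion system on a group `P`: the category whose objects are the subgroups of `P`, where
`Hom Q R` is a set of injective group homomorphisms containing all the homomorphisms induced by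
conjugation by elements of `P`, is closed under composition (identities are conjugations by `1`),
and every morphism is an isomorphism of the category followed by an inclusion. -/
structure FusionSystem (P : Type*) [Group P] where
  /-- The morphisms from `Q` to `R`. -/
  Hom (Q R : Subgroup P) : Set (Q →* R)
  injective {Q R : Subgroup P} {φ : Q →* R} : φ ∈ Hom Q R → Function.Injective φ
  conj_mem {Q R : Subgroup P} {φ : Q →* R} (g : P) :
    (∀ u : Q, (φ u : P) = g * u * g⁻¹) → φ ∈ Hom Q R
  comp_mem {Q R S : Subgroup P} {φ : Q →* R} {ψ : R →* S} :
    φ ∈ Hom Q R → ψ ∈ Hom R S → ψ.comp φ ∈ Hom Q S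
  factor {Q R : Subgroup P} {φ : Q →* R} : φ ∈ Hom Q R →
    ∃ (S : Subgroup P) (hS : S ≤ R) (α : Q ≃* S), α.toMonoidHom ∈ Hom Q S ∧
      α.symm.toMonoidHom ∈ Hom S Q ∧ φ = (Subgroup.inclusion hS).comp α.toMonoidHom

namespace FusionSystem

variable {P : Type*} [Group P]

/-- For an injective homomorphism `j : P → M`, the fusion system on `P` whose morphisms are the
homomorphisms that are induced, through `j`, by conjugation by elements of `M`. If `P ≤ M` and `j`
is the inclusion, this is the fusion system `F_P(M)` of `M` on `P`. -/
def ofEmbedding {M : Type*} [Group M] (j : P →* M) (hj : Function.Injective j) :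
    FusionSystem P where
  Hom Q R := {φ | ∃ g : M, ∀ u : Q, j (φ u) = g * j u * g⁻¹}
  injective := by
    rintro Q R φ ⟨g, hg⟩ u v huv
    have h : g * j u * g⁻¹ = g * j v * g⁻¹ := by rw [← hg, ← hg, huv]
    exact Subtype.ext (hj (by simpa using h))
  conj_mem := by
    intro Q R φ g hg
    exact ⟨j g, fun u => by rw [hg]; simp⟩
  comp_mem := by
    rintro Q R S φ ψ ⟨g, hg⟩ ⟨h, hh⟩
    exact ⟨h * g, fun u => by simp [hg, hh, mul_assoc]⟩
  factor := by
    rintro Q R φ ⟨g, hg⟩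
    have hφ : Function.Injective (R.subtype.comp φ) := by
      intro u v huv
      have huv' : (φ u : P) = φ v := huv
      have h : g * j u * g⁻¹ = g * j v * g⁻¹ := by rw [← hg, ← hg, huv']
      exact Subtype.ext (hj (by simpa using h))
    refine ⟨(R.subtype.comp φ).range, ?_, MonoidHom.ofInjective hφ, ⟨g, hg⟩, ⟨g⁻¹, ?_⟩, ?_⟩
    · rintro _ ⟨u, rfl⟩
      exact (φ u).2
    · intro v
      obtain ⟨u, rfl⟩ := (MonoidHom.ofInjective hφ).surjective v
      have h : j (((MonoidHom.ofInjective hφ) u : (R.subtype.comp φ).range) : P)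
          = g * j u * g⁻¹ := hg u
      simp only [MulEquiv.toMonoidHom_eq_coe, MonoidHom.coe_coe, MulEquiv.symm_apply_apply]
      rw [h]
      group
    · rfl

variable (F : FusionSystem P)

/-- An isomorphism of groups between subgroups of `P` that is an isomorphism of the category. -/
def IsIso {Q R : Subgroup P} (α : Q ≃* R) : Prop :=
  α.toMonoidHom ∈ F.Hom Q R ∧ α.symm.toMonoidHom ∈ F.Hom R Q

/-- The group `Aut_F(Q)` of automorphisms of `Q` in the fusion system. -/
def aut (Q : Subgroup P) : Subgroup (MulAut Q) where
  carrier := {α | F.IsIso α}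
  one_mem' := ⟨F.conj_mem 1 (by intro u; simp), F.conj_mem 1 (by intro u; simp; rfl)⟩
  mul_mem' := by
    rintro α β ⟨hα, hα'⟩ ⟨hβ, hβ'⟩
    exact ⟨F.comp_mem hβ hα, F.comp_mem hα' hβ'⟩
  inv_mem' := by
    rintro α ⟨hα, hα'⟩
    exact ⟨hα', hα⟩

/-- The group `Aut_P(Q)` of automorphisms of `Q` induced by conjugation by elements of `N_P(Q)`. -/
def autP (Q : Subgroup P) : Subgroup (MulAut Q) := Q.normalizerMonoidHom.range

/-- `Q` is fully automized: `Aut_P(Q)` is a Sylow `p`-subgroup of `Aut_F(Q)`. -/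
def IsFullyAutomized (p : ℕ) (Q : Subgroup P) : Prop :=
  ∃ S : Sylow p (F.aut Q), (S : Subgroup (F.aut Q)) = (autP Q).subgroupOf (F.aut Q)

/-- For an isomorphism `φ : R → Q`, the subgroup `N_φ` of all `g ∈ N_P(R)` such that
`φ ∘ c_g ∘ φ⁻¹` lies in `Aut_P(Q)`, where `c_g` is conjugation by `g` on `R`. -/
def extender {R Q : Subgroup P} (φ : R ≃* Q) : Subgroup P :=
  ((autP Q).comap ((MulAut.congr φ).toMonoidHom.comp R.normalizerMonoidHom)).map
    (Subgroup.normalizer (R : Set P)).subtype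

/-- `Q` is receptive: every isomorphism `φ : R → Q` of the fusion system extends to a morphism
from `N_φ` to `P`. -/
def IsReceptive (Q : Subgroup P) : Prop :=
  ∀ (R : Subgroup P) (φ : R ≃* Q), F.IsIso φ →
    ∃ ψ ∈ F.Hom (extender φ) ⊤,
      ∀ (u : R) (v : extender φ), (v : P) = u → (ψ v : P) = φ u

/-- The fusion system is saturated: every subgroup of `P` is isomorphic, in the fusion system, to
one that is fully automized and receptive. -/
def IsSaturated (p : ℕ) : Prop :=
  ∀ R : Subgroup P, ∃ (Q : Subgroup P) (α : R ≃* Q),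
    F.IsIso α ∧ F.IsFullyAutomized p Q ∧ F.IsReceptive Q

/-- `Q` is normal in the fusion system: `Q` is normal in `P` and every morphism `φ : R → S` extends
to a morphism `ψ : RQ → SQ` with `ψ(Q) = Q`. -/
def IsNormal (Q : Subgroup P) : Prop :=
  Q.Normal ∧ ∀ (R S : Subgroup P), ∀ φ ∈ F.Hom R S, ∃ ψ ∈ F.Hom (R ⊔ Q) (S ⊔ Q),
    (∀ (u : R) (v : (R ⊔ Q : Subgroup P)), (v : P) = u → (ψ v : P) = φ u) ∧
    (Q.subgroupOf (R ⊔ Q)).map ψ = Q.subgroupOf (S ⊔ Q)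

/-- `O_p(F)`, the largest subgroup that is normal in the fusion system (the subgroup generated by
all of them). -/
def core : Subgroup P := sSup {Q | F.IsNormal Q}

/-- The fusion system is constrained: it is saturated and `C_P(O_p(F)) ≤ O_p(F)`. -/
def IsConstrained (p : ℕ) : Prop :=
  F.IsSaturated p ∧ Subgroup.centralizer (F.core : Set P) ≤ F.core

end FusionSystem

/-! ### Models -/

/-- `O_p(M)`, the largest normal `p`-subgroup (of a finite group). -/
def opCore (p : ℕ) (M : Type*) [Group M] : Subgroup M :=
  sSup {N | N.Normal ∧ IsPGroup p N}

/-- `O_{p'}(M)`, the largest normal subgroup of order prime to `p` (of a finite group). -/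
def opPrimeCore (p : ℕ) (M : Type*) [Group M] : Subgroup M :=
  sSup {N | N.Normal ∧ (Nat.card N).Coprime p}

instance opPrimeCore_normal (p : ℕ) (M : Type*) [Group M] : (opPrimeCore p M).Normal :=
  Subgroup.sSup_normal _ fun _ h => h.1

/-- `M` is `p`-constrained: with `M' = M / O_{p'}(M)`, one has `C_{M'}(O_p(M')) ≤ O_p(M')`. -/
def IsPConstrained (p : ℕ) (M : Type*) [Group M] : Prop :=
  Subgroup.centralizer (opCore p (M ⧸ opPrimeCore p M) : Set (M ⧸ opPrimeCore p M)) ≤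
    opCore p (M ⧸ opPrimeCore p M)

/-- `M` is strictly `p`-constrained: it is `p`-constrained and `O_{p'}(M) = 1`. -/
def IsStrictlyPConstrained (p : ℕ) (M : Type*) [Group M] : Prop :=
  IsPConstrained p M ∧ opPrimeCore p M = ⊥

/-- The (finite) group `M`, in which `P` is embedded by `j`, is a model for the fusion system `F`
on `P`: it is strictly `p`-constrained, `P` is a Sylow `p`-subgroup of it, and `F = F_P(M)`. -/
structure IsModel (p : ℕ) {P M : Type*} [Group P] [Group M] (F : FusionSystem P) (j : P →* M) :
    Prop where
  injective : Function.Injective j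
  sylow : ∃ S : Sylow p M, (S : Subgroup M) = j.range
  strictlyPConstrained : IsStrictlyPConstrained p M
  eq_ofEmbedding : F = FusionSystem.ofEmbedding j injective

/-! ### Park's group -/

/-- Park's group: the group of all bijections of the `P`-`P`-biset `M` that preserve the right
`P`-action, where `P` is embedded in `M` by `j` and acts by right multiplication. -/
def parkGroup {P M : Type*} [Group P] [Group M] (j : P →* M) : Subgroup (Equiv.Perm M) where
  carrier := {f | ∀ (m : M) (u : P), f (m * j u) = f m * j u}
  one_mem' := by intro m u; rfl
  mul_mem' := by
    intro f g hf hg m u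
    rw [Equiv.Perm.mul_apply, hg, hf, Equiv.Perm.mul_apply]
  inv_mem' := by
    intro f hf m u
    rw [Equiv.Perm.inv_eq_iff_eq, hf, ← Equiv.Perm.mul_apply, mul_inv_cancel, Equiv.Perm.one_apply]

/-- Park's embedding `ι : M → Park(F, M)`, where `ι m` is left multiplication by `m`. -/
def parkEmbedding {P M : Type*} [Group P] [Group M] (j : P →* M) : M →* parkGroup j where
  toFun m := ⟨Equiv.mulLeft m, fun x u => by simp [mul_assoc]⟩
  map_one' := by ext x; simp
  map_mul' a b := by ext x; simp

/-- The wreath product `P ≀ S_n`, the semidirect product of `P^n` by `S_n` where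
`(σ · x) i = x (σ⁻¹ i)`. -/
abbrev WreathSymm (P : Type*) [Group P] (n : ℕ) : Type _ :=
  (Fin n → P) ⋊[(mulAutArrow : Equiv.Perm (Fin n) →* MulAut (Fin n → P))] Equiv.Perm (Fin n)

/-! ### Scott modules -/

/-- The permutation module `Ind_H^G(k)`. -/
noncomputable abbrev indTrivial (k : Type*) [CommRing k] {G : Type*} [Group G] (H : Subgroup G) :
    Representation k G (Representation.IndV H.subtype (Representation.trivial k H k)) :=
  Representation.ind H.subtype (Representation.trivial k H k)

/-- A representation is indecomposable if it is nonzero and is not the direct sum of two nonzero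
subrepresentations. -/
def IsIndecomposableRep {k G V : Type*} [CommRing k] [Group G] [AddCommGroup V] [Module k V]
    (ρ : Representation k G V) : Prop :=
  Nontrivial V ∧ ∀ A B : Subrepresentation ρ, IsCompl A B → A = ⊥ ∨ B = ⊥

/-- `σ` is isomorphic to a direct summand of `ρ`. -/
def IsSummandRep {k G V W : Type*} [CommRing k] [Group G] [AddCommGroup V] [Module k V]
    [AddCommGroup W] [Module k W] (σ : Representation k G W) (ρ : Representation k G V) : Prop :=
  ∃ A B : Subrepresentation ρ, IsCompl A B ∧ Nonempty (σ.Equiv A.toRepresentation)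

/-- `σ` is (a representative of the isomorphism class of) the Scott module `Sc(G, H)`: it is an
indecomposable direct summand of `Ind_H^G(k)` whose socle contains the trivial module, that is,
which has a nonzero `G`-fixed vector. -/
def IsScottModule {k G W : Type*} [Field k] [Group G] [AddCommGroup W] [Module k W]
    (H : Subgroup G) (σ : Representation k G W) : Prop :=
  IsIndecomposableRep σ ∧ IsSummandRep σ (indTrivial k H) ∧ σ.invariants ≠ ⊥

/-! Induced trivial modules are permutation modules on cosets. Since `P` is Sylow in `M`, the index
of `ιP` in `ιM` is prime to `p`, so averaging over the fibres of `G ⧸ ιP → G ⧸ ιM` splits off the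
module on `G ⧸ ιM`, and the constants are fixed vectors. Fixed vectors of a transitive permutation
module form a line, so by Fitting's lemma two indecomposable summands meeting that line are
isomorphic; this is the uniqueness of Scott modules.

The heart is indecomposability on `X = G ⧸ ιM` (`isIndecomposableRep_permRep`). The base group `N`
of `G` is a normal `p`-subgroup. If the fixed points on `X` of each stabilizer `N_x` lie in the
`N`-orbit of `x`, then orbit counting mod `p` shows that an endomorphism acts on the `N`-fixed
vectors as a scalar. An idempotent therefore acts there as 0 or 1, and since every nonzero submodule
contains a nonzero `N`-fixed vector, it is 0 or 1 everywhere.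

The orbit condition comes from `mul_parkEmbedding_inv_mem_parkBase`. The core `Q` of `P` in `M`
embeds into `N`, and an `f` in `G` conjugating `ιQ` into `ιM` differs from left multiplication by `f
1` by elements centralizing `Q`. Strict `p`-constraint puts these elements in `Q`, whence `f ∈ N ·
ιM`.

The wreath product appears because `M` is a free right `P`-set of rank `|M : P|`. -/

/-! ### Direct summands, Fitting's lemma and uniqueness of Scott modules -/

section Summands

variable {k G V W U : Type*} [Field k] [Group G] [AddCommGroup V] [Module k V]
  [AddCommGroup W] [Module k W] [AddCommGroup U] [Module k U]
  {ρ : Representation k G V} {σ : Representation k G W} {τ : Representation k G U}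

open Representation

theorem Subrepresentation.isCompl_iff_toSubmodule {A B : Subrepresentation ρ} :
    IsCompl A B ↔ IsCompl A.toSubmodule B.toSubmodule := by
  have hle : ∀ C D : Subrepresentation ρ, C ≤ D ↔ C.toSubmodule ≤ D.toSubmodule :=
    fun C D => Iff.rfl
  rw [isCompl_iff, isCompl_iff, disjoint_iff_inf_le, disjoint_iff_inf_le, codisjoint_iff_le_sup,
    codisjoint_iff_le_sup, hle, hle]
  rfl

/-- A retract is a direct summand. -/
theorem isSummandRep_of_retract (i : σ.IntertwiningMap ρ) (r : ρ.IntertwiningMap σ)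
    (h : ∀ w, r (i w) = w) : IsSummandRep σ ρ := by
  refine ⟨i.range, r.ker, ?_, ⟨?_⟩⟩
  · rw [Subrepresentation.isCompl_iff_toSubmodule]
    refine isCompl_iff.2 ⟨Submodule.disjoint_def.2 ?_, codisjoint_iff_le_sup.2 fun v _ => ?_⟩
    · rintro _ ⟨w, rfl⟩ hw
      have hw' : r (i w) = 0 := hw
      rw [h] at hw'
      rw [hw', map_zero]
    · refine Submodule.mem_sup.2 ⟨i (r v), ⟨r v, rfl⟩, v - i (r v), ?_, by abel⟩
      change r (v - i (r v)) = 0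
      rw [map_sub, h, sub_self]
  · refine Representation.Equiv.mk (LinearEquiv.ofInjective i.toLinearMap
      (Function.LeftInverse.injective (g := r) h)) fun g => ?_
    ext w
    exact IntertwiningMap.isIntertwining _ _ i g w

/-- A direct summand is a retract. -/
theorem IsSummandRep.exists_retract (h : IsSummandRep σ ρ) :
    ∃ (i : σ.IntertwiningMap ρ) (r : ρ.IntertwiningMap σ), ∀ w, r (i w) = w := by
  obtain ⟨A, B, hAB, ⟨e⟩⟩ := h
  rw [Subrepresentation.isCompl_iff_toSubmodule] at hAB
  refine ⟨⟨A.toSubmodule.subtype ∘ₗ e.toLinearMap, fun g => ?_⟩,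
    ⟨e.symm.toLinearMap ∘ₗ A.toSubmodule.projectionOnto B.toSubmodule hAB, fun g => ?_⟩, fun w => ?_⟩
  · ext w
    exact congrArg Subtype.val (IntertwiningMap.isIntertwining _ _ e.toIntertwiningMap g w)
  · ext v
    have key : A.toSubmodule.projectionOnto B.toSubmodule hAB (ρ g v) =
        A.toRepresentation g (A.toSubmodule.projectionOnto B.toSubmodule hAB v) := by
      obtain ⟨a, ha, b, hb, rfl⟩ := Submodule.mem_sup.1
        (hAB.sup_eq_top.ge (Submodule.mem_top : v ∈ ⊤))
      have h1 := Submodule.projectionOnto_apply_left hAB ⟨a, ha⟩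
      have h2 := Submodule.projectionOnto_apply_left hAB ⟨ρ g a, A.apply_mem_toSubmodule g ha⟩
      have h3 := Submodule.projectionOnto_apply_right hAB ⟨b, hb⟩
      have h4 := Submodule.projectionOnto_apply_right hAB ⟨ρ g b, B.apply_mem_toSubmodule g hb⟩
      simp only at h1 h2 h3 h4
      rw [map_add, map_add, map_add, h1, h2, h3, h4, add_zero, add_zero]
      rfl
    change e.symm (A.toSubmodule.projectionOnto B.toSubmodule hAB (ρ g v)) = _
    rw [key]
    exact IntertwiningMap.isIntertwining _ _ e.symm.toIntertwiningMap g _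
  · change e.symm (A.toSubmodule.projectionOnto B.toSubmodule hAB (e w : A.toSubmodule)) = w
    rw [Submodule.projectionOnto_apply_left]
    exact e.symm_apply_apply w

/-- A representation is indecomposable if it has no nontrivial idempotent endomorphisms. -/
theorem isIndecomposableRep_of_idempotent [Nontrivial V]
    (h : ∀ e : ρ.IntertwiningMap ρ, (∀ v, e (e v) = e v) → (∀ v, e v = 0) ∨ ∀ v, e v = v) :
    IsIndecomposableRep ρ := by
  refine ⟨inferInstance, fun A B hAB => ?_⟩
  have hs : IsSummandRep A.toRepresentation ρ := ⟨A, B, hAB, ⟨Representation.Equiv.refl _⟩⟩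
  rw [Subrepresentation.isCompl_iff_toSubmodule] at hAB
  obtain ⟨e, he, heA, heB⟩ : ∃ e : ρ.IntertwiningMap ρ, (∀ v, e (e v) = e v) ∧
      (∀ v ∈ A.toSubmodule, e v = v) ∧ ∀ v ∈ B.toSubmodule, e v = 0 := by
    have hp : ∀ a ∈ A.toSubmodule, ∀ b ∈ B.toSubmodule,
        A.toSubmodule.projection B.toSubmodule hAB (a + b) = a := by
      intro a ha b hb
      have h1 := Submodule.projection_apply_left hAB ⟨a, ha⟩
      have h2 := Submodule.projection_apply_right hAB ⟨b, hb⟩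
      simp only at h1 h2
      rw [map_add, h1, h2, add_zero]
    have hd : ∀ v, ∃ a ∈ A.toSubmodule, ∃ b ∈ B.toSubmodule, a + b = v := fun v =>
      Submodule.mem_sup.1 (hAB.sup_eq_top.ge (Submodule.mem_top : v ∈ ⊤))
    refine ⟨⟨A.toSubmodule.projection B.toSubmodule hAB, fun g => ?_⟩, fun v => ?_,
      fun v hv => ?_, fun v hv => ?_⟩
    · ext v
      obtain ⟨a, ha, b, hb, rfl⟩ := hd v
      rw [LinearMap.comp_apply, LinearMap.comp_apply, hp a ha b hb, map_add,
        hp _ (A.apply_mem_toSubmodule g ha) _ (B.apply_mem_toSubmodule g hb)]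
    · obtain ⟨a, ha, b, hb, rfl⟩ := hd v
      change A.toSubmodule.projection _ hAB (A.toSubmodule.projection _ hAB _) =
        A.toSubmodule.projection _ hAB _
      rw [hp a ha b hb]
      simpa using hp a ha 0 (zero_mem _)
    · simpa using hp v hv 0 (zero_mem _)
    · simpa using hp 0 (zero_mem _) v hv
  rcases h e he with h0 | h1
  · exact Or.inl (Subrepresentation.toSubmodule_injective
      ((Submodule.eq_bot_iff _).2 fun v hv => by rw [← heA v hv, h0]))
  · exact Or.inr (Subrepresentation.toSubmodule_injective
      ((Submodule.eq_bot_iff _).2 fun v hv => by rw [← h1 v, heB v hv]))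

/-- The image of a subrepresentation under an isomorphism. -/
def Subrepresentation.mapEquiv (φ : ρ.Equiv σ) (A : Subrepresentation ρ) : Subrepresentation σ where
  toSubmodule := A.toSubmodule.map φ.toLinearEquiv.toLinearMap
  apply_mem_toSubmodule g := by
    rintro _ ⟨v, hv, rfl⟩
    exact ⟨ρ g v, A.apply_mem_toSubmodule g hv, IntertwiningMap.isIntertwining _ _ φ.toIntertwiningMap g v⟩

theorem IsIndecomposableRep.of_equiv (hσ : IsIndecomposableRep σ) (φ : ρ.Equiv σ) :
    IsIndecomposableRep ρ := by
  have := hσ.1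
  refine ⟨φ.toLinearEquiv.toEquiv.nontrivial, fun A B hAB => ?_⟩
  have hbot : ∀ C : Subrepresentation ρ, C.mapEquiv φ = ⊥ → C = ⊥ := by
    intro C hC
    apply Subrepresentation.toSubmodule_injective
    have h : C.toSubmodule.map φ.toLinearEquiv.toLinearMap = ⊥ :=
      congrArg Subrepresentation.toSubmodule hC
    exact (Submodule.map_eq_bot_iff (e := φ.toLinearEquiv)).1 h
  refine (hσ.2 (A.mapEquiv φ) (B.mapEquiv φ) ?_).imp (hbot A) (hbot B)
  rw [Subrepresentation.isCompl_iff_toSubmodule] at hAB ⊢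
  exact hAB.map (Submodule.orderIsoMapComap φ.toLinearEquiv)

/-- Fitting's lemma: an endomorphism of a finite-dimensional indecomposable representation that
fixes a nonzero vector is bijective. -/
theorem IsIndecomposableRep.bijective_of_fixed [FiniteDimensional k V] (hρ : IsIndecomposableRep ρ)
    (f : ρ.IntertwiningMap ρ) {v : V} (hv : v ≠ 0) (hf : f v = v) : Function.Bijective f := by
  have hcomm : ∀ (n : ℕ) (g : G) (w : V), (f.toLinearMap ^ n) (ρ g w) =
      ρ g ((f.toLinearMap ^ n) w) := by
    intro n g
    induction n with
    | zero => intro w; rfl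
    | succ n ih =>
      intro w
      rw [pow_succ, Module.End.mul_apply, Module.End.mul_apply]
      change (f.toLinearMap ^ n) (f (ρ g w)) = _
      rw [f.isIntertwining, ih]
      rfl
  -- Fitting decomposition into the generalized kernel `K` and the eventual image `R`. The fixed
  -- vector `v` lies in `R`, so indecomposability forces `K` to vanish.
  let K : Subrepresentation ρ := ⟨⨆ n, LinearMap.ker (f.toLinearMap ^ n), by
    intro g w hw
    have hdir := Monotone.directed_le f.toLinearMap.iterateKer.monotone
    change Directed _ (fun n => LinearMap.ker (f.toLinearMap ^ n)) at hdir
    rw [Submodule.mem_iSup_of_directed _ hdir] at hw ⊢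
    obtain ⟨n, hn⟩ := hw
    refine ⟨n, ?_⟩
    rw [LinearMap.mem_ker] at hn ⊢
    rw [hcomm, hn, map_zero]⟩
  let R : Subrepresentation ρ := ⟨⨅ n, LinearMap.range (f.toLinearMap ^ n), by
    intro g w hw
    rw [Submodule.mem_iInf] at hw ⊢
    intro n
    obtain ⟨u, rfl⟩ := hw n
    exact ⟨ρ g u, hcomm n g u⟩⟩
  have hKR : IsCompl K R := Subrepresentation.isCompl_iff_toSubmodule.2
    (LinearMap.isCompl_iSup_ker_pow_iInf_range_pow f.toLinearMap)
  have hfn : ∀ n : ℕ, (f.toLinearMap ^ n) v = v := by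
    intro n
    induction n with
    | zero => rfl
    | succ n ih =>
      rw [pow_succ, Module.End.mul_apply]
      change (f.toLinearMap ^ n) (f v) = v
      rw [hf, ih]
  have hR : R ≠ ⊥ := by
    intro h
    have hvR : v ∈ R.toSubmodule := (Submodule.mem_iInf _).2 fun n => ⟨v, hfn n⟩
    rw [h] at hvR
    exact hv hvR
  have hK : K = ⊥ := (hρ.2 K R hKR).resolve_right hR
  have hinj : Function.Injective f.toLinearMap := by
    rw [← LinearMap.ker_eq_bot, eq_bot_iff]
    intro w hw
    have hwK : w ∈ K.toSubmodule :=
      (le_iSup (fun n => LinearMap.ker (f.toLinearMap ^ n)) 1) (by simpa using hw)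
    rw [hK] at hwK
    exact hwK
  exact ⟨hinj, LinearMap.injective_iff_surjective.1 hinj⟩

theorem Representation.IntertwiningMap.map_mem_invariants (f : ρ.IntertwiningMap σ) {v : V} (hv : v ∈ ρ.invariants) :
    f v ∈ σ.invariants := fun g => by
  rw [← f.isIntertwining, hv g]

/-- Two indecomposable summands with nonzero fixed vectors of a finite-dimensional representation
with one-dimensional fixed space are isomorphic. -/
theorem nonempty_equiv_of_isSummandRep [FiniteDimensional k V]
    (hinv : ∀ u ∈ ρ.invariants, ∀ v ∈ ρ.invariants, u ≠ 0 → ∃ c : k, v = c • u)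
    (hσ : IsIndecomposableRep σ) (hσρ : IsSummandRep σ ρ) (hσ0 : σ.invariants ≠ ⊥)
    (hτ : IsIndecomposableRep τ) (hτρ : IsSummandRep τ ρ) (hτ0 : τ.invariants ≠ ⊥) :
    Nonempty (σ.Equiv τ) := by
  obtain ⟨i, r, hri⟩ := hσρ.exists_retract
  obtain ⟨i', r', hri'⟩ := hτρ.exists_retract
  obtain ⟨a, ha, ha0⟩ := (Submodule.ne_bot_iff _).1 hσ0
  obtain ⟨b, hb, hb0⟩ := (Submodule.ne_bot_iff _).1 hτ0
  have : FiniteDimensional k W := FiniteDimensional.of_injective i.toLinearMap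
    (Function.LeftInverse.injective (g := r) hri)
  have : FiniteDimensional k U := FiniteDimensional.of_injective i'.toLinearMap
    (Function.LeftInverse.injective (g := r') hri')
  have hia : i a ≠ 0 := fun h => ha0 (by rw [← hri a, h, map_zero])
  obtain ⟨c, hc⟩ := hinv _ (Representation.IntertwiningMap.map_mem_invariants i ha) _
    (Representation.IntertwiningMap.map_mem_invariants i' hb) hia
  have hc0 : c ≠ 0 := by
    rintro rfl
    rw [zero_smul] at hc
    exact hb0 (by rw [← hri' b, hc, map_zero])
  -- Inside `ρ` the two fixed vectors are proportional, so going from `σ` to `τ` and back multiplies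
  -- by `c⁻¹` and then by `c`. Both round trips thus fix a nonzero vector, and Fitting's lemma
  -- applies to each.
  have h1 : r' (i a) = c⁻¹ • b := by
    rw [← hri' b, hc, map_smul, smul_smul, inv_mul_cancel₀ hc0, one_smul]
  have h2 : r (i' b) = c • a := by rw [hc, map_smul, hri]
  have hβα : Function.Bijective ((r.comp i').comp (r'.comp i)) :=
    hσ.bijective_of_fixed _ ha0 (by
      change r (i' (r' (i a))) = a
      rw [h1, map_smul, map_smul, h2, smul_smul, inv_mul_cancel₀ hc0, one_smul])
  have hαβ : Function.Bijective ((r'.comp i).comp (r.comp i')) :=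
    hτ.bijective_of_fixed _ hb0 (by
      change r' (i (r (i' b))) = b
      rw [h2, map_smul, map_smul, h1, smul_smul, mul_inv_cancel₀ hc0, one_smul])
  have hα : Function.Bijective (r'.comp i) :=
    ⟨Function.Injective.of_comp (f := r.comp i') hβα.1,
      Function.Surjective.of_comp (g := r.comp i') hαβ.2⟩
  exact ⟨Representation.Equiv.mk (LinearEquiv.ofBijective (r'.comp i).toLinearMap hα) fun g => by
    ext w
    exact IntertwiningMap.isIntertwining _ _ (r'.comp i) g w⟩

end Summands

/-! ### Permutation representations -/

section PermRep

open Representation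

/-- The permutation representation of `G` on the functions on a `G`-set. -/
def permRep (k G X : Type*) [CommRing k] [Group G] [MulAction G X] : Representation k G (X → k) where
  toFun g := LinearMap.funLeft k k (g⁻¹ • ·)
  map_one' := by ext; simp [LinearMap.funLeft_apply]
  map_mul' g h := by
    refine LinearMap.ext fun v => funext fun x => ?_
    simp [LinearMap.funLeft_apply, mul_smul]

section CommRing

variable {k G X : Type*} [CommRing k] [Group G] [MulAction G X]

theorem permRep_apply (g : G) (v : X → k) (x : X) : permRep k G X g v x = v (g⁻¹ • x) := rfl

theorem permRep_single [DecidableEq X] (g : G) (x : X) (a : k) :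
    permRep k G X g (Pi.single x a) = Pi.single (g • x) a := by
  funext y
  rw [permRep_apply, Pi.single_apply, Pi.single_apply]
  simp only [inv_smul_eq_iff]

theorem permRep_invariants_apply_eq [MulAction.IsPretransitive G X] {v : X → k}
    (hv : v ∈ (permRep k G X).invariants) (x y : X) : v x = v y := by
  obtain ⟨g, rfl⟩ := MulAction.exists_smul_eq G x y
  have h := congrFun (hv g) (g • x)
  rwa [permRep_apply, inv_smul_smul] at h

end CommRing

variable {k G X : Type*} [Field k] [Group G] [MulAction G X]

/-- An invariant function is constant on a transitive `G`-set. This is the input for the uniqueness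
of Scott modules. -/
theorem permRep_invariants_eq_smul [MulAction.IsPretransitive G X] :
    ∀ u ∈ (permRep k G X).invariants, ∀ v ∈ (permRep k G X).invariants, u ≠ 0 →
      ∃ c : k, v = c • u := by
  intro u hu v hv hu0
  obtain ⟨x, hx⟩ := Function.ne_iff.1 hu0
  refine ⟨v x / u x, funext fun y => ?_⟩
  rw [Pi.smul_apply, smul_eq_mul, permRep_invariants_apply_eq hv y x,
    permRep_invariants_apply_eq hu y x, div_mul_cancel₀ _ hx]

theorem permRep_invariants_ne_bot [Nonempty X] : (permRep k G X).invariants ≠ ⊥ := by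
  refine (Submodule.ne_bot_iff _).2 ⟨fun _ => 1, fun g => rfl, fun h => ?_⟩
  exact one_ne_zero (congrFun h (Classical.arbitrary X))

/-- If all fibres of a map of `G`-sets `X → Y` have a given cardinality, which is nonzero in `k`,
then the permutation module on `Y` is a direct summand of the one on `X`. -/
theorem isSummandRep_permRep_of_fibers {Y : Type*} [MulAction G Y] [Finite X] (π : X → Y)
    (hπ : ∀ (g : G) (x : X), π (g • x) = g • π x) (n : ℕ) (hn : (n : k) ≠ 0)
    (hcard : ∀ y, Nat.card {x // π x = y} = n) :
    IsSummandRep (permRep k G Y) (permRep k G X) := by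
  classical
  have := Fintype.ofFinite X
  let i : (permRep k G Y).IntertwiningMap (permRep k G X) := ⟨LinearMap.funLeft k k π, fun g => by
    refine LinearMap.ext fun v => funext fun x => ?_
    change v (g⁻¹ • π x) = v (π (g⁻¹ • x))
    rw [hπ]⟩
  -- The retraction of the pullback along `π` is the average over each fibre.
  let r₀ : (X → k) →ₗ[k] (Y → k) :=
    { toFun := fun v y => (n : k)⁻¹ * ∑ x with π x = y, v x
      map_add' := fun u v => funext fun y => by
        simp [Finset.sum_add_distrib, mul_add]
      map_smul' := fun c v => funext fun y => by
        simp only [Pi.smul_apply, smul_eq_mul, ← Finset.mul_sum, RingHom.id_apply]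
        ring }
  let r : (permRep k G X).IntertwiningMap (permRep k G Y) := ⟨r₀, fun g => by
    refine LinearMap.ext fun v => funext fun y => ?_
    change (n : k)⁻¹ * ∑ x with π x = y, v (g⁻¹ • x) = (n : k)⁻¹ * ∑ x with π x = g⁻¹ • y, v x
    congr 1
    refine Finset.sum_equiv (MulAction.toPerm g⁻¹) (fun x => ?_) fun x _ => rfl
    simp [hπ]⟩
  refine isSummandRep_of_retract i r fun v => funext fun y => ?_
  change (n : k)⁻¹ * ∑ x with π x = y, v (π x) = v y
  rw [Finset.sum_congr rfl (g := fun _ => v y) fun x hx => by rw [(Finset.mem_filter.1 hx).2],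
    Finset.sum_const, ← Fintype.card_subtype, ← Nat.card_eq_fintype_card, hcard, nsmul_eq_mul,
    ← mul_assoc, inv_mul_cancel₀ hn, one_mul]

/-- Every fibre of `G ⧸ H → G ⧸ K` is in bijection with `K ⧸ H`, so averaging over fibres divides by
the relative index. -/
theorem isSummandRep_permRep_quotient [Finite G] {H K : Subgroup G} (hHK : H ≤ K)
    (hn : ((H.relIndex K : ℕ) : k) ≠ 0) :
    IsSummandRep (permRep k G (G ⧸ K)) (permRep k G (G ⧸ H)) := by
  let e := Subgroup.quotientEquivProdOfLE hHK
  have he : ∀ x, (e x).1 = Subgroup.quotientMapOfLE hHK x := by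
    intro x
    induction x using QuotientGroup.induction_on with
    | H g => rfl
  refine isSummandRep_permRep_of_fibers (Subgroup.quotientMapOfLE hHK) ?_ _ hn fun y => ?_
  · intro g x
    induction x using QuotientGroup.induction_on with
    | H x => rfl
  · refine Nat.card_congr (⟨fun x => (e x.1).2, fun z => ⟨e.symm (y, z), ?_⟩, ?_, ?_⟩ :
      {x // Subgroup.quotientMapOfLE hHK x = y} ≃ K ⧸ H.subgroupOf K)
    · rw [← he, Equiv.apply_symm_apply]
    · rintro ⟨x, hx⟩
      apply Subtype.ext
      change e.symm (y, (e x).2) = x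
      rw [Equiv.symm_apply_eq]
      exact Prod.ext (by rw [he, hx]) rfl
    · intro z
      change (e (e.symm (y, z))).2 = z
      rw [Equiv.apply_symm_apply]

/-- The module induced from the trivial module of a subgroup is the permutation module on the
cosets. -/
theorem nonempty_indTrivial_equiv_permRep [Finite G] (H : Subgroup G) :
    Nonempty ((indTrivial k H).Equiv (permRep k G (G ⧸ H))) := by
  classical
  have := Fintype.ofFinite (G ⧸ H)
  let σ := Representation.trivial k H k
  have hmk : ∀ (s : H) (g : G) (a : k), IndV.mk H.subtype σ (s * g) a = IndV.mk H.subtype σ g a := by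
    intro s g a
    have h := Coinvariants.mk_self_apply
      (Representation.tprod ((leftRegular k G).comp H.subtype) σ) s
      (TensorProduct.tmul k (MonoidAlgebra.single g (1 : k)) a)
    simpa [σ] using h
  -- By `hmk` the generators depend only on the right coset `Hg`; inversion turns it into the left
  -- coset `g⁻¹H`.
  let f : IndV H.subtype σ →ₗ[k] (G ⧸ H → k) := Coinvariants.lift _
    (TensorProduct.lift (((Finsupp.lift _ k G fun g =>
      LinearMap.single k (fun _ : G ⧸ H => k) (QuotientGroup.mk g⁻¹))) ∘ₗ
        (MonoidAlgebra.coeffLinearEquiv k).toLinearMap)) (by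
      intro s
      ext g x
      simp [σ])
  have hf : ∀ (g : G) (a : k), f (IndV.mk H.subtype σ g a) = Pi.single (QuotientGroup.mk g⁻¹) a := by
    intro g a
    simp [f]
  let f' : (G ⧸ H → k) →ₗ[k] IndV H.subtype σ :=
    LinearMap.lsum k (fun _ : G ⧸ H => k) k fun x => IndV.mk H.subtype σ x.out⁻¹
  have hf' : ∀ (x : G ⧸ H) (a : k), f' (Pi.single x a) = IndV.mk H.subtype σ x.out⁻¹ a := by
    intro x a
    exact LinearMap.lsum_piSingle ..
  refine ⟨Representation.Equiv.mk (LinearEquiv.ofLinearMap f f' ?_ ?_) fun g => ?_⟩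
  · refine LinearMap.pi_ext fun x a => ?_
    rw [LinearMap.comp_apply, hf', hf, inv_inv, QuotientGroup.out_eq', LinearMap.id_apply]
  · refine IndV.hom_ext _ _ fun g => LinearMap.ext fun a => ?_
    change f' (f (IndV.mk H.subtype σ g a)) = IndV.mk H.subtype σ g a
    obtain ⟨s, hs⟩ := QuotientGroup.mk_out_eq_mul H g⁻¹
    rw [hf, hf', hs, mul_inv_rev, inv_inv]
    exact hmk s⁻¹ g a
  · refine IndV.hom_ext _ _ fun h => LinearMap.ext fun a => ?_
    change f (ind H.subtype σ g (IndV.mk H.subtype σ h a)) =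
      permRep k G (G ⧸ H) g (f (IndV.mk H.subtype σ h a))
    rw [ind_mk, hf, hf, permRep_single, mul_inv_rev, inv_inv]
    rfl

end PermRep

/-! ### `p`-groups in characteristic `p` -/

section PGroup

open Representation

variable {p : ℕ} [Fact p.Prime] {k : Type*} [Field k] [CharP k p]

/-- In characteristic `p`, the sum of the values of a function that is invariant under a `p`-group
is the sum of its values at the fixed points. -/
theorem IsPGroup.sum_eq_sum_fixedPoints {S X : Type*} [Group S] [MulAction S X] [Fintype X]
    (hS : IsPGroup p S) (f : X → k) (hf : ∀ (s : S) (x : X), f (s • x) = f x)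
    [DecidablePred fun x : X => ∀ s : S, s • x = x] :
    ∑ x, f x = ∑ x with ∀ s : S, s • x = x, f x := by
  classical
  rw [← Finset.sum_fiberwise_of_maps_to (s := Finset.univ) (t := Finset.univ.image f) (g := f)
      (fun x hx => Finset.mem_image_of_mem f hx),
    ← Finset.sum_fiberwise_of_maps_to (t := Finset.univ.image f) (g := f)
      (fun x _ => Finset.mem_image_of_mem f (Finset.mem_univ x))]
  refine Finset.sum_congr rfl fun b _ => ?_
  rw [Finset.sum_congr rfl (g := fun _ => b) fun x hx => (Finset.mem_filter.1 hx).2,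
    Finset.sum_congr rfl (s₁ := Finset.filter _ (Finset.filter _ _)) (g := fun _ => b)
      fun x hx => (Finset.mem_filter.1 hx).2, Finset.sum_const, Finset.sum_const,
    nsmul_eq_mul, nsmul_eq_mul]
  congr 1
  -- Each level set of `f` is stable under `S`, so its cardinality is congruent mod `p` to its
  -- number of fixed points.
  let Y : SubMulAction S X := ⟨{x | f x = b}, fun s x hx => (hf s x).trans hx⟩
  have h := hS.card_modEq_card_fixedPoints Y
  rw [← CharP.natCast_eq_natCast k p] at h
  convert h using 2
  · rw [Nat.card_eq_fintype_card, ← Fintype.card_subtype]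
    exact Fintype.card_congr (Equiv.refl _)
  · rw [Finset.filter_filter, ← Fintype.card_subtype, ← Nat.card_eq_fintype_card]
    refine Nat.card_congr ⟨fun x => ⟨⟨x.1, x.2.2⟩, fun s => Subtype.ext (x.2.1 s)⟩,
      fun y => ⟨y.1.1, fun s => congrArg Subtype.val (y.2 s), y.1.2⟩, fun _ => rfl, fun _ => rfl⟩

/-- In characteristic `p`, a finite `p`-group has a nonzero fixed vector in every nonzero
invariant subspace. -/
theorem IsPGroup.exists_fixed_ne_zero {G V : Type*} [Group G] [AddCommGroup V] [Module k V]
    (ρ : Representation k G V) (N : Subgroup G) [Finite N] (hN : IsPGroup p N)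
    (A : Subrepresentation ρ) (hA : A ≠ ⊥) :
    ∃ v ∈ A.toSubmodule, v ≠ 0 ∧ ∀ n ∈ N, ρ n v = v := by
  have := Fintype.ofFinite N
  have hA' : A.toSubmodule ≠ ⊥ := fun h => hA (Subrepresentation.toSubmodule_injective h)
  obtain ⟨w, hw, hw0⟩ := (Submodule.ne_bot_iff _).1 hA'
  have hpV : ∀ v : V, p • v = 0 := fun v => by
    rw [← Nat.cast_smul_eq_nsmul k, CharP.cast_eq_zero, zero_smul]
  -- The field `k` may be infinite, so counting takes place in the additive span of one orbit: it is
  -- finitely generated of exponent `p`, hence finite, and `p` divides its order. As 0 is a fixed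
  -- point, there is another.
  let Y : AddSubgroup V := AddSubgroup.closure (Set.range fun n : N => ρ n w)
  have hYA : ∀ y ∈ Y, y ∈ A.toSubmodule := by
    have : Y ≤ A.toSubmodule.toAddSubgroup := (AddSubgroup.closure_le _).2 (by
      rintro _ ⟨n, rfl⟩
      exact A.apply_mem_toSubmodule n hw)
    exact fun y hy => this hy
  have hYN : ∀ (n : N), ∀ y ∈ Y, ρ n y ∈ Y := by
    intro n
    have : Y ≤ Y.comap (ρ (n : G)).toAddMonoidHom := (AddSubgroup.closure_le _).2 (by
      rintro _ ⟨m, rfl⟩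
      refine AddSubgroup.subset_closure ⟨n * m, ?_⟩
      change ρ ((n : G) * m) w = ρ n (ρ m w)
      rw [map_mul]
      rfl)
    exact fun y hy => this hy
  have hYfin : Finite Y := by
    have hfg : AddGroup.FG Y := (AddGroup.fg_iff_addSubgroup_fg Y).2
      ⟨(Set.finite_range fun n : N => ρ n w).toFinset, by rw [Set.Finite.coe_toFinset]⟩
    have htor : IsAddTorsion Y := fun y => isOfFinAddOrder_iff_nsmul_eq_zero.2
      ⟨p, (Fact.out : p.Prime).pos, Subtype.ext (hpV y)⟩
    exact AddCommGroup.finite_of_fg_isAddTorsion Y htor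
  let act : MulAction N Y :=
    { smul := fun n y => ⟨ρ n y, hYN n y y.2⟩
      one_smul := fun y => Subtype.ext (by
        change ρ ((1 : N) : G) (y : V) = y
        rw [Subgroup.coe_one, map_one]
        rfl)
      mul_smul := fun m n y => Subtype.ext (by
        change ρ ((m * n : N) : G) (y : V) = ρ m (ρ n y)
        rw [Subgroup.coe_mul, map_mul]
        rfl) }
  have hwY : w ∈ Y := AddSubgroup.subset_closure ⟨1, by simp⟩
  have hdvd : p ∣ Nat.card Y := by
    have h : addOrderOf (⟨w, hwY⟩ : Y) = p :=
      addOrderOf_eq_prime (Subtype.ext (hpV w)) fun h => hw0 (congrArg Subtype.val h)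
    rw [← h]
    exact addOrderOf_dvd_natCard _
  obtain ⟨y, hy, hy0⟩ := hN.exists_fixed_point_of_prime_dvd_card_of_fixed_point Y hdvd (a := 0)
    fun n => Subtype.ext (map_zero (ρ (n : G)))
  refine ⟨y, hYA y y.2, fun h => hy0 (Subtype.ext h.symm), fun n hn => ?_⟩
  exact congrArg Subtype.val (hy ⟨n, hn⟩)

/-- Let `N` be a normal `p`-subgroup of `G`, and let `X` be a transitive `G`-set such that the
fixed points of each point stabilizer in `N` lie in a single orbit of `N`. Then the permutation
module on `X` in characteristic `p` is indecomposable. -/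
theorem isIndecomposableRep_permRep {G X : Type*} [Group G] [MulAction G X] [Finite X] [Nonempty X]
    [MulAction.IsPretransitive G X] (N : Subgroup G) [N.Normal] [Finite N] (hN : IsPGroup p N)
    (h : ∀ x y : X, (∀ n ∈ N, n • x = x → n • y = y) → ∃ n ∈ N, n • x = y) :
    IsIndecomposableRep (permRep k G X) := by
  classical
  have := Fintype.ofFinite X
  have : Nontrivial (X → k) := Function.nontrivial
  refine isIndecomposableRep_of_idempotent fun e he => ?_
  -- The matrix of `e`, constant on `G`-orbits of pairs.
  let E : X → X → k := fun y x => e (Pi.single y 1) x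
  have hE : ∀ (v : X → k) (x : X), e v x = ∑ y, v y * E y x := by
    intro v x
    have h1 := congrFun (LinearMap.pi_apply_eq_sum_univ e.toLinearMap v) x
    change e v x = _ at h1
    rw [h1, Finset.sum_apply]
    refine Finset.sum_congr rfl fun y _ => ?_
    rw [Pi.smul_apply, smul_eq_mul]
    have hy : (fun z => if y = z then (1 : k) else 0) = Pi.single y 1 := by
      funext z
      rw [Pi.single_apply]
      simp only [eq_comm]
    rw [hy]
    rfl
  have hEg : ∀ (g : G) (y x : X), E (g • y) (g • x) = E y x := by
    intro g y x
    change e (Pi.single (g • y) 1) (g • x) = e (Pi.single y 1) x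
    rw [← permRep_single, IntertwiningMap.isIntertwining, permRep_apply, inv_smul_smul]
  let D : X → X → Prop := fun x y => ∀ n ∈ N, n • x = x → n • y = y
  have hD : ∀ (g : G) (x y : X), D x y → D (g • x) (g • y) := by
    intro g x y hxy n hn hnx
    have h1 := hxy (g⁻¹ * n * g) (by simpa using ‹N.Normal›.conj_mem n hn g⁻¹) (by
      rw [mul_smul, mul_smul, hnx, inv_smul_smul])
    rwa [mul_smul, mul_smul, inv_smul_eq_iff] at h1
  let c : X → k := fun x => ∑ y with D x y, E y x
  have hcg : ∀ (g : G) (x : X), c (g • x) = c x := by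
    intro g x
    refine (Finset.sum_equiv (MulAction.toPerm g) (fun y => ?_) fun y _ => ?_).symm
    · simp only [Finset.mem_filter, Finset.mem_univ, true_and, MulAction.toPerm_apply]
      refine ⟨hD g x y, fun hy => ?_⟩
      simpa using hD g⁻¹ _ _ hy
    · exact (hEg g y x).symm
  -- The summand `v y * E y x` is invariant in `y` under `N_x`, so only the `y` fixed by `N_x`
  -- contribute. By `h` these lie in the `N`-orbit of `x`, where `v` takes the value `v x`.
  have hev : ∀ v : X → k, (∀ n ∈ N, permRep k G X n v = v) → ∀ x, e v x = c x * v x := by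
    intro v hv x
    have hv' : ∀ n ∈ N, ∀ y, v (n • y) = v y := by
      intro n hn y
      have h1 := congrFun (hv n hn) (n • y)
      rw [permRep_apply, inv_smul_smul] at h1
      exact h1.symm
    have hS : IsPGroup p (N ⊓ MulAction.stabilizer G x : Subgroup G) := hN.to_le inf_le_left
    rw [hE, hS.sum_eq_sum_fixedPoints (fun y => v y * E y x) ?_, Finset.sum_mul]
    · refine Finset.sum_congr ?_ fun y hy => ?_
      · ext y
        simp only [Finset.mem_filter, Finset.mem_univ, true_and]
        exact ⟨fun hy n hn hnx => hy ⟨n, hn, hnx⟩, fun hy s => hy s s.2.1 s.2.2⟩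
      · obtain ⟨n, hn, rfl⟩ := h x y (Finset.mem_filter.1 hy).2
        rw [hv' n hn, mul_comm]
    · rintro ⟨s, hs, hsx⟩ y
      change v (s • y) * E (s • y) x = v y * E y x
      have h1 := hEg s y x
      rw [show s • x = x from hsx] at h1
      rw [hv' s hs, h1]
  obtain ⟨x₀⟩ := ‹Nonempty X›
  have hev' : ∀ v : X → k, (∀ n ∈ N, permRep k G X n v = v) → e v = c x₀ • v := by
    intro v hv
    funext x
    obtain ⟨g, rfl⟩ := MulAction.exists_smul_eq G x₀ x
    rw [hev v hv, hcg]
    rfl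
  -- Idempotence tested on the constant function 1.
  have hc : c x₀ = 0 ∨ c x₀ = 1 := by
    have h1 := hev' (fun _ => 1) fun _ _ => rfl
    have h2 := he fun _ => 1
    rw [h1, map_smul, h1] at h2
    have h3 := congrFun h2 x₀
    simp only [Pi.smul_apply, smul_eq_mul, mul_one] at h3
    by_cases h0 : c x₀ = 0
    · exact Or.inl h0
    · exact Or.inr (mul_left_cancel₀ h0 (by rw [h3, mul_one]))
  rcases hc with hc | hc
  · left
    by_contra! hne
    obtain ⟨v, hv⟩ := hne
    have hA : e.range ≠ ⊥ := fun hbot => by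
      have h1 : e v ∈ e.range.toSubmodule := ⟨v, rfl⟩
      rw [hbot] at h1
      exact hv h1
    obtain ⟨_, ⟨u, rfl⟩, hu0, hu⟩ := hN.exists_fixed_ne_zero _ N e.range hA
    refine hu0 ?_
    have h1 := hev' _ hu
    rw [hc, zero_smul] at h1
    exact (he u).symm.trans h1
  · right
    by_contra! hne
    obtain ⟨v, hv⟩ := hne
    have hA : e.ker ≠ ⊥ := fun hbot => by
      have h1 : e v - v ∈ e.ker.toSubmodule := by
        change e (e v - v) = 0
        rw [map_sub, he, sub_self]
      rw [hbot] at h1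
      exact hv (sub_eq_zero.1 h1)
    obtain ⟨u, hu1, hu0, hu⟩ := hN.exists_fixed_ne_zero _ N e.ker hA
    have h1 := hev' _ hu
    rw [hc, one_smul] at h1
    exact hu0 (h1.symm.trans hu1)

end PGroup

/-! ### The base group of Park's group -/

section ParkBase

variable {p : ℕ} {P M : Type*} [Group P] [Group M] (j : P →* M)

/-- The base group of Park's group: the bijections that stabilize every left coset of `P`. -/
def parkBase : Subgroup (parkGroup j) where
  carrier := {f | ∀ m : M, ∃ u : P, f.1 m = m * j u}
  one_mem' := fun m => ⟨1, by simp⟩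
  mul_mem' := by
    intro f g hf hg m
    obtain ⟨u, hu⟩ := hg m
    obtain ⟨v, hv⟩ := hf m
    refine ⟨v * u, ?_⟩
    rw [Subgroup.coe_mul, Equiv.Perm.mul_apply, hu, f.2, hv, map_mul, mul_assoc]
  inv_mem' := by
    intro f hf m
    obtain ⟨u, hu⟩ := hf m
    refine ⟨u⁻¹, ?_⟩
    rw [Subgroup.coe_inv, Equiv.Perm.inv_eq_iff_eq, f.2, hu, mul_assoc, ← map_mul,
      mul_inv_cancel, map_one, mul_one]

variable {j}

instance parkBase_normal : (parkBase j).Normal where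
  conj_mem := by
    intro f hf g m
    obtain ⟨u, hu⟩ := hf ((g⁻¹ : parkGroup j).1 m)
    refine ⟨u, ?_⟩
    rw [Subgroup.coe_mul, Subgroup.coe_mul, Equiv.Perm.mul_apply, Equiv.Perm.mul_apply, hu, g.2,
      Subgroup.coe_inv]
    exact congrArg (· * j u) (g.1.apply_symm_apply m)

theorem pow_apply_of_apply_eq {f : parkGroup j} {m : M} {u : P} (h : f.1 m = m * j u) (n : ℕ) :
    (f ^ n).1 m = m * j (u ^ n) := by
  induction n with
  | zero => simp
  | succ n ih =>
    rw [pow_succ, Subgroup.coe_mul, Equiv.Perm.mul_apply, h, (f ^ n).2, ih, mul_assoc, ← map_mul,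
      pow_succ]

/-- Powers of a base element move `m` by powers of a single `u : P`, so the order of `P` is a
uniform exponent. -/
theorem isPGroup_parkBase [Fact p.Prime] [Finite P] (hP : IsPGroup p P) :
    IsPGroup p (parkBase j) := by
  obtain ⟨a, ha⟩ := IsPGroup.iff_card.1 hP
  rintro ⟨f, hf⟩
  refine ⟨a, Subtype.ext (Subtype.ext (Equiv.ext fun m => ?_))⟩
  obtain ⟨u, hu⟩ := hf m
  change (f ^ p ^ a).1 m = m
  rw [pow_apply_of_apply_eq hu, ← ha, pow_card_eq_one', map_one, mul_one]

/-- Write `q * m = m * (m⁻¹ * q * m)`: the second factor lies in `P` for every `m`. -/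
theorem parkEmbedding_mem_parkBase {q : M} (hq : q ∈ j.range.normalCore) :
    parkEmbedding j q ∈ parkBase j := by
  intro m
  obtain ⟨u, hu⟩ := hq m⁻¹
  exact ⟨u, by rw [hu]; change q * m = _; group⟩

/-- If the core `Q` of `P` in `M` contains its centralizer, then an element of Park's group
that conjugates `Q` into `M` lies in the product of the base group and `M`. -/
theorem mul_parkEmbedding_inv_mem_parkBase
    (hC : ∀ c : M, (∀ q ∈ j.range.normalCore, c * q = q * c) → c ∈ j.range.normalCore)
    (f : parkGroup j)
    (hf : ∀ q ∈ j.range.normalCore, f⁻¹ * parkEmbedding j q * f ∈ (parkEmbedding j).range) :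
    f * (parkEmbedding j (f.1 1))⁻¹ ∈ parkBase j := by
  have hcomm : ∀ x : M, f.1 x * x⁻¹ * (f.1 1)⁻¹ ∈ j.range.normalCore := by
    intro x
    refine hC _ fun q hq => ?_
    obtain ⟨q', hq'⟩ := hf q hq
    have hbase : parkEmbedding j q' ∈ parkBase j := by
      have h := (parkBase_normal (j := j)).conj_mem _ (parkEmbedding_mem_parkBase hq) f⁻¹
      rwa [inv_inv, ← hq'] at h
    have hmul : f * parkEmbedding j q' = parkEmbedding j q * f := by rw [hq']; group
    -- Because `ι q'` is in the base group, `x⁻¹ * q' * x` lies in `P` and can be pulled out of `f`.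
    -- Comparing a general `x` with `x = 1` eliminates `q'`.
    have hx : ∀ x : M, q * f.1 x = f.1 x * (x⁻¹ * q' * x) := by
      intro x
      have h1 : f.1 (q' * x) = q * f.1 x := congrArg (fun h : parkGroup j => h.1 x) hmul
      obtain ⟨u, hu⟩ := hbase x
      have hu' : q' * x = x * j u := hu
      have h2 : x⁻¹ * q' * x = j u := by rw [mul_assoc, hu']; group
      rw [← h1, h2, hu', f.2]
    have h1 := hx 1
    rw [inv_one, one_mul, mul_one] at h1
    have h3 : q' = (f.1 1)⁻¹ * q * f.1 1 := by rw [mul_assoc, h1]; group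
    have h4 := hx x
    rw [h3] at h4
    calc f.1 x * x⁻¹ * (f.1 1)⁻¹ * q
        = f.1 x * (x⁻¹ * ((f.1 1)⁻¹ * q * f.1 1) * x) * x⁻¹ * (f.1 1)⁻¹ := by group
      _ = q * (f.1 x * x⁻¹ * (f.1 1)⁻¹) := by rw [← h4]; group
  intro z
  obtain ⟨u, hu⟩ := (j.range.normalCore_normal.conj_mem _ (hcomm ((f.1 1)⁻¹ * z)) z⁻¹) 1
  refine ⟨u, ?_⟩
  rw [hu]
  change f.1 ((f.1 1)⁻¹ * z) = _
  group

/-- If `x = a ιM` and `y = b ιM`, the conjugate of `ιQ` by `a`, with `Q` the normal core, lies in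
the base group and fixes `x`. It then fixes `y`, so `a⁻¹ * b` conjugates `ιQ` into `ιM`. -/
theorem exists_mem_parkBase_smul_eq
    (hC : ∀ c : M, (∀ q ∈ j.range.normalCore, c * q = q * c) → c ∈ j.range.normalCore)
    (x y : parkGroup j ⧸ (parkEmbedding j).range)
    (h : ∀ n ∈ parkBase j, n • x = x → n • y = y) : ∃ n ∈ parkBase j, n • x = y := by
  induction x using QuotientGroup.induction_on with
  | H a =>
  induction y using QuotientGroup.induction_on with
  | H b =>
  have key := mul_parkEmbedding_inv_mem_parkBase hC (a⁻¹ * b) fun q hq => by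
    have h1 := h (a * parkEmbedding j q * a⁻¹)
      (parkBase_normal.conj_mem _ (parkEmbedding_mem_parkBase hq) a) (by
        rw [MulAction.Quotient.smul_mk, smul_eq_mul, QuotientGroup.eq]
        exact ⟨q⁻¹, by rw [map_inv]; group⟩)
    rw [MulAction.Quotient.smul_mk, smul_eq_mul, eq_comm, QuotientGroup.eq] at h1
    convert h1 using 1
    group
  refine ⟨_, parkBase_normal.conj_mem _ key a, ?_⟩
  rw [MulAction.Quotient.smul_mk, smul_eq_mul, QuotientGroup.eq]
  exact ⟨((a⁻¹ * b).1 1), by group⟩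

end ParkBase

/-! ### Consequences of strict `p`-constraint -/

section Constrained

variable {p : ℕ} {M : Type*} [Group M]

/-- The join of `S` and `N` is a `p`-group, so it equals `S` by maximality. -/
theorem le_normalCore_of_isPGroup (S : Sylow p M) {N : Subgroup M} (hN : N.Normal)
    (hNp : IsPGroup p N) : N ≤ (S : Subgroup M).normalCore := by
  refine Subgroup.normal_le_normalCore.2 ?_
  have h := S.is_maximal' (S.isPGroup'.to_sup_of_normal_right hNp) le_sup_left
  exact h ▸ le_sup_right

/-- In a strictly `p`-constrained group, the core of a Sylow `p`-subgroup contains its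
centralizer. -/
theorem IsStrictlyPConstrained.mem_normalCore (h : IsStrictlyPConstrained p M) (S : Sylow p M)
    {c : M} (hc : ∀ q ∈ (S : Subgroup M).normalCore, c * q = q * c) :
    c ∈ (S : Subgroup M).normalCore := by
  obtain ⟨hcon, hbot⟩ := h
  let π : M →* M ⧸ opPrimeCore p M := QuotientGroup.mk' _
  have hinj : Function.Injective π := by
    rw [← MonoidHom.ker_eq_bot_iff, QuotientGroup.ker_mk', hbot]
  have hle : opCore p (M ⧸ opPrimeCore p M) ≤ (S : Subgroup M).normalCore.map π := by
    refine sSup_le fun N hN => ?_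
    have hNn := hN.1
    rw [← Subgroup.map_comap_eq_self_of_surjective (QuotientGroup.mk'_surjective _) N]
    exact Subgroup.map_mono (le_normalCore_of_isPGroup S (hNn.comap π)
      (hN.2.comap_of_injective π hinj))
  have hcent : π c ∈ opCore p (M ⧸ opPrimeCore p M) := hcon (Subgroup.mem_centralizer_iff.2
    fun x hx => by
      obtain ⟨q, hq, rfl⟩ := hle hx
      rw [← map_mul, ← map_mul, hc q hq])
  obtain ⟨q, hq, hqc⟩ := hle hcent
  rwa [← hinj hqc]

end Constrained

/-! ### Park's group as a wreath product -/

section Wreath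

variable {P M : Type*} [Group P] [Group M]

/-- The action of the wreath product on `Fin n × P`. -/
instance wreathSymmAction (n : ℕ) : MulAction (WreathSymm P n) (Fin n × P) where
  smul w x := (w.right x.1, w.left (w.right x.1) * x.2)
  one_smul x := Prod.ext rfl (one_mul x.2)
  mul_smul w z x := by
    refine Prod.ext rfl ?_
    change w.left (w.right (z.right x.1)) *
      z.left (w.right⁻¹ (w.right (z.right x.1))) * x.2 = w.left _ * (z.left _ * x.2)
    rw [show w.right⁻¹ (w.right (z.right x.1)) = z.right x.1 from w.right.symm_apply_apply _,
      mul_assoc]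
    rfl

theorem wreathSymm_smul_def {n : ℕ} (w : WreathSymm P n) (x : Fin n × P) :
    w • x = (w.right x.1, w.left (w.right x.1) * x.2) := rfl

/-- If `M` is free of rank `n` as a right `P`-set, then Park's group is isomorphic to `P ≀ S_n`. -/
theorem nonempty_parkGroup_mulEquiv_of_equiv {n : ℕ} (j : P →* M) (Θ : Fin n × P ≃ M)
    (hΘ : ∀ (i : Fin n) (u v : P), Θ (i, u * v) = Θ (i, u) * j v) :
    Nonempty (parkGroup j ≃* WreathSymm P n) := by
  have hΘ' : ∀ (m : M) (v : P), Θ.symm (m * j v) = ((Θ.symm m).1, (Θ.symm m).2 * v) := by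
    intro m v
    rw [Equiv.symm_apply_eq, hΘ, Prod.mk.eta, Equiv.apply_symm_apply]
  let A : WreathSymm P n →* Equiv.Perm M :=
    Θ.permCongrHom.toMonoidHom.comp (MulAction.toPermHom (WreathSymm P n) (Fin n × P))
  have hA : ∀ w m, A w m = Θ (w • Θ.symm m) := fun w m => rfl
  let B : WreathSymm P n →* parkGroup j := A.codRestrict (parkGroup j) fun w m u => by
    rw [hA, hA, hΘ', wreathSymm_smul_def, wreathSymm_smul_def, ← mul_assoc, hΘ]
  have hB : ∀ w m, (B w).1 m = Θ (w • Θ.symm m) := fun w m => rfl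
  refine ⟨(MulEquiv.ofBijective B ⟨?_, ?_⟩).symm⟩
  · rw [injective_iff_map_eq_one]
    intro w hw
    have h1 : ∀ x : Fin n × P, w • x = x := by
      intro x
      have h := congrArg (fun f : parkGroup j => f.1 (Θ x)) hw
      simp only [hB, Equiv.symm_apply_apply] at h
      exact Θ.injective h
    have h2 : w.right = 1 := Equiv.ext fun i => congrArg Prod.fst (h1 (i, 1))
    refine SemidirectProduct.ext (funext fun i => ?_) h2
    have h3 := congrArg Prod.snd (h1 (i, 1))
    rw [wreathSymm_smul_def, h2] at h3
    simpa using h3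
  · intro f
    -- In these coordinates `f` is right `P`-equivariant, hence determined by the points `(i, 1)`:
    -- first coordinates give the permutation, second ones the base component.
    let F : Fin n × P ≃ Fin n × P := (Θ.trans f.1).trans Θ.symm
    have hF : ∀ i u v, F (i, u * v) = ((F (i, u)).1, (F (i, u)).2 * v) := by
      intro i u v
      change Θ.symm (f.1 (Θ (i, u * v))) = _
      rw [hΘ, f.2, hΘ']
      rfl
    have hF1 : ∀ i u, F (i, u) = ((F (i, 1)).1, (F (i, 1)).2 * u) := by
      intro i u
      rw [← hF, one_mul]
    have hsurj : Function.Surjective fun i => (F (i, 1)).1 := by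
      intro i
      refine ⟨(F.symm (i, 1)).1, ?_⟩
      have h := hF1 (F.symm (i, 1)).1 (F.symm (i, 1)).2
      rw [Prod.mk.eta, Equiv.apply_symm_apply] at h
      exact (congrArg Prod.fst h).symm
    let s : Equiv.Perm (Fin n) :=
      Equiv.ofBijective _ ⟨Finite.injective_iff_surjective.2 hsurj, hsurj⟩
    have hs : ∀ i, s i = (F (i, 1)).1 := fun i => rfl
    -- The action reads the base component at the image index, hence `s.symm`.
    refine ⟨⟨fun i => (F (s.symm i, 1)).2, s⟩, Subtype.ext (Equiv.ext fun m => ?_)⟩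
    rw [hB, wreathSymm_smul_def]
    simp only [Equiv.symm_apply_apply]
    rw [hs, ← hF1, Prod.mk.eta]
    change Θ (Θ.symm (f.1 (Θ (Θ.symm m)))) = _
    simp only [Equiv.apply_symm_apply]

theorem nonempty_parkGroup_mulEquiv [Finite M] (j : P →* M) (hj : Function.Injective j) :
    Nonempty (parkGroup j ≃* WreathSymm P j.range.index) := by
  let ε : (M ⧸ j.range) ≃ Fin j.range.index := Finite.equivFin _
  let t : Fin j.range.index → M := fun i => (ε.symm i).out
  have ht : ∀ i u, ε (QuotientGroup.mk (t i * j u)) = i := by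
    intro i u
    rw [QuotientGroup.mk_mul_of_mem _ (MonoidHom.mem_range.2 ⟨u, rfl⟩), QuotientGroup.out_eq', Equiv.apply_symm_apply]
  refine nonempty_parkGroup_mulEquiv_of_equiv j
    (Equiv.ofBijective (fun x : Fin j.range.index × P => t x.1 * j x.2) ⟨?_, fun m => ?_⟩)
    fun i u v => ?_
  · rintro ⟨i, u⟩ ⟨i', u'⟩ h
    have h' : t i * j u = t i' * j u' := h
    have hi : i = i' := by rw [← ht i u, h', ht]
    subst hi
    exact Prod.ext rfl (hj (mul_left_cancel h'))
  · obtain ⟨⟨_, u, rfl⟩, hu⟩ := QuotientGroup.mk_out_eq_mul j.range m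
    refine ⟨(ε (QuotientGroup.mk m), u⁻¹), ?_⟩
    change (ε.symm (ε (QuotientGroup.mk m))).out * j u⁻¹ = m
    rw [Equiv.symm_apply_apply, hu, map_inv, mul_inv_cancel_right]
  · change t i * j (u * v) = t i * j u * j v
    rw [map_mul, mul_assoc]

end Wreath

/-! ### Transport along isomorphisms and the main theorem -/

theorem parkEmbedding_injective {P M : Type*} [Group P] [Group M] (j : P →* M) :
    Function.Injective (parkEmbedding j) := fun a b h => by
  have h1 : a * 1 = b * 1 := congrArg (fun f : parkGroup j => f.1 1) h
  simpa using h1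

theorem Representation.invariants_ne_bot_of_equiv {k G V W : Type*} [CommRing k] [Group G]
    [AddCommGroup V] [Module k V] [AddCommGroup W] [Module k W] {ρ : Representation k G V}
    {σ : Representation k G W} (φ : ρ.Equiv σ) (h : σ.invariants ≠ ⊥) : ρ.invariants ≠ ⊥ := by
  obtain ⟨w, hw, hw0⟩ := (Submodule.ne_bot_iff _).1 h
  refine (Submodule.ne_bot_iff _).2 ⟨φ.symm w, fun g => ?_, fun h0 => hw0 ?_⟩
  · have h1 := IntertwiningMap.isIntertwining _ _ φ.symm.toIntertwiningMap g w
    rw [hw g] at h1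
    exact h1.symm
  · rw [← φ.apply_symm_apply w, h0]
    exact map_zero φ.toLinearEquiv

theorem IsSummandRep.of_equiv {k G V W V' W' : Type*} [Field k] [Group G]
    [AddCommGroup V] [Module k V] [AddCommGroup W] [Module k W]
    [AddCommGroup V'] [Module k V'] [AddCommGroup W'] [Module k W']
    {ρ : Representation k G V} {σ : Representation k G W}
    {ρ' : Representation k G V'} {σ' : Representation k G W'}
    (h : IsSummandRep σ ρ) (φ : σ'.Equiv σ) (ψ : ρ'.Equiv ρ) : IsSummandRep σ' ρ' := by
  obtain ⟨i, r, hri⟩ := h.exists_retract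
  refine isSummandRep_of_retract ((ψ.symm.toIntertwiningMap.comp i).comp φ.toIntertwiningMap)
    ((φ.symm.toIntertwiningMap.comp r).comp ψ.toIntertwiningMap) fun w => ?_
  change φ.symm (r (ψ (ψ.symm (i (φ w))))) = w
  rw [ψ.apply_symm_apply, hri, φ.symm_apply_apply]

/-- Scott modules are unique up to isomorphism. -/
theorem IsScottModule.nonempty_equiv {k G W W' : Type*} [Field k] [Group G] [Finite G]
    [AddCommGroup W] [Module k W] [AddCommGroup W'] [Module k W'] {H : Subgroup G}
    {σ : Representation k G W} {τ : Representation k G W'} (hσ : IsScottModule H σ)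
    (hτ : IsScottModule H τ) : Nonempty (σ.Equiv τ) := by
  obtain ⟨φ⟩ := nonempty_indTrivial_equiv_permRep (k := k) H
  exact nonempty_equiv_of_isSummandRep permRep_invariants_eq_smul
    hσ.1 (hσ.2.1.of_equiv (.refl σ) φ.symm) hσ.2.2 hτ.1 (hτ.2.1.of_equiv (.refl τ) φ.symm) hτ.2.2

theorem theorem3p4 (p : ℕ) [Fact p.Prime]
    (k : Type*) [Field k] [IsAlgClosed k] [CharP k p]
    {P : Type*} [Group P] [Finite P] (hP : IsPGroup p P)
    (F : FusionSystem P) (hF : F.IsConstrained p)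
    {M : Type*} [Group M] [Finite M] (j : P →* M) (hM : IsModel p F j) :
    -- the group `G = parkGroup j` is isomorphic to `P ≀ S_n`
    Nonempty (parkGroup j ≃* WreathSymm P j.range.index) ∧
    -- `Ind_{ιM}^G(k)` is a Scott module of `G` with respect to `ιP`
    IsScottModule ((parkEmbedding j).comp j).range (indTrivial k (parkEmbedding j).range) ∧
    -- and every Scott module of `G` with respect to `ιP` is isomorphic to it
    ∀ {W : Type*} [AddCommGroup W] [Module k W] (σ : Representation k (parkGroup j) W),
      IsScottModule ((parkEmbedding j).comp j).range σ →
        Nonempty (σ.Equiv (indTrivial k (parkEmbedding j).range)) := by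
  obtain ⟨S, hS⟩ := hM.sylow
  have hC : ∀ c : M, (∀ q ∈ j.range.normalCore, c * q = q * c) → c ∈ j.range.normalCore := by
    rw [← hS]
    exact fun c hc => hM.strictlyPConstrained.mem_normalCore S hc
  obtain ⟨φ⟩ := nonempty_indTrivial_equiv_permRep (k := k) (parkEmbedding j).range
  obtain ⟨ψ⟩ := nonempty_indTrivial_equiv_permRep (k := k) ((parkEmbedding j).comp j).range
  have hle : ((parkEmbedding j).comp j).range ≤ (parkEmbedding j).range := by
    rintro _ ⟨u, rfl⟩
    exact ⟨j u, rfl⟩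
  -- Injectivity of `ι` reduces this to the index of a Sylow `p`-subgroup of `M`.
  have hidx : ((((parkEmbedding j).comp j).range.relIndex (parkEmbedding j).range : ℕ) : k) ≠ 0 := by
    rw [MonoidHom.range_comp, MonoidHom.range_eq_map (parkEmbedding j),
      Subgroup.relIndex_map_map_of_injective _ _ (parkEmbedding_injective j),
      Subgroup.relIndex_top_right, Ne, CharP.cast_eq_zero_iff k p, ← hS]
    exact S.not_dvd_index
  have hscott : IsScottModule ((parkEmbedding j).comp j).range
      (indTrivial k (parkEmbedding j).range) :=
    ⟨(isIndecomposableRep_permRep (parkBase j) (isPGroup_parkBase hP)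
        (exists_mem_parkBase_smul_eq hC)).of_equiv φ,
      (isSummandRep_permRep_quotient hle hidx).of_equiv φ ψ,
      Representation.invariants_ne_bot_of_equiv φ permRep_invariants_ne_bot⟩
  exact ⟨nonempty_parkGroup_mulEquiv j hM.injective, hscott, fun σ hσ => hσ.nonempty_equiv hscott⟩
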